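/- For positive integers $k_1,\dots,k_d$ and complex $z_1,\dots,z_d$ put $$\mathrm{Li}_{k_1,\dots,k_d}(z_1,\dots,z_d)=\lim_{M\to\infty}\ \sum_{M\ge n_1>\cdots>n_d>0}\frac{z_1^{n_1}\cdots z_d^{n_d}}{n_1^{k_1}\cdots n_d^{k_d}}$$ whenever the limit exists, and for a (possibly empty) composition $\mathbf k=(k_1,\dots,k_d)$ of positive integers put $|\mathbf k|=k_1+\cdots+k_d$ and $$H_M(\mathbf k)=\sum_{M\ge n_1>\cdots>n_d>0}\frac1{n_1^{k_1}\cdots n_d^{k_d}},\qquad H_M(\emptyset)=1.$$ Let $\mathrm{CMZV}^N_w\subset\mathbb C$ be the $\mathbb Q$-span of all values $\mathrm{Li}_{k_1,\dots,k_d}(\eta_1,\dots,\eta_d)$ with positive integers $k_i$, $k_1+\cdots+k_d=w$, $N$-th roots of unity $\eta_i$, and $(k_1,\eta_1)\ne(1,1)$. Theorem. Let $N\ge2$, $1\le j<N$, $\theta=2j\pi/N$ and $\mu=e^{i\theta}$. Let $(F_n)_{n\ge1}$ be the sequence of real numbers with $$F_1=\begin{cases}1,&2j=N,\\ (\pi-\theta)\csc\theta,&2j\neq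 N,\end{cases}\qquad F_2=\begin{cases}1/3,&2j=N,\\ (F_1\cos\theta+1)\csc^2\theta,&2j\ne N,\end{cases}$$ $$n\sin^2\theta\,F_{n+1}-(2n-1)\cos\theta\,F_n-(n-1)F_{n-1}=0\qquad(n\ge2).$$ Then for every integer $l\ge1$ and every composition $\mathbf k$ of positive integers (possibly empty) the following series converges and $$\sum_{n\ge1}\frac{H_{n-1}(\mathbf k)}{n^l}(1-\cos\theta)^nF_n\in\mathrm{CMZV}^N_{|\mathbf k|+l+1}.$$ In particular, $$\sum_{n\ge1}\frac{(1-\cos\theta)^nF_n}{n}=2\zeta(2)-\mathrm{Li}_2(\mu)-\mathrm{Li}_2(\bar\mu)\in\mathrm{CMZV}^N_2,$$ $$\sum_{n\ge1}\frac{(1-\cos\theta)^nF_n}{n^2}=\sum_{\eta=\mu,\bar\mu}\Big(2\mathrm{Li}_{2,1}(\eta,\bar\eta)-\mathrm{Li}_{2,1}(\eta,1)-\mathrm{Li}_{2,1}(\eta,\bar\eta^2)\Big)+2\zeta(3)-\mathrm{Li}_3(\mu)-\mathrm{Li}_3(\bar\mu)\in\mathrm{CMZV}^N_3,$$ where for $\mu=\bar\mu=-1$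 the sum over $\eta$ still has two (equal) terms. -/

import Mathlib

open Filter Topology

/-- The multiple harmonic sum
`H_M(k₁,…,k_d) = ∑_{M ≥ n₁ > ⋯ > n_d > 0} 1 / (n₁^{k₁} ⋯ n_d^{k_d})`, with `H_M(∅) = 1`,
computed by summing over the outermost index `n₁ = n` first. -/
noncomputable def multipleHarmonicSum : List ℕ → ℕ → ℝ
  | [], _ => 1
  | k :: ks, M => ∑ n ∈ Finset.Icc 1 M, 1 / (n : ℝ) ^ k * multipleHarmonicSum ks (n - 1)

/-- The truncated multiple polylogarithm
`∑_{M ≥ n₁ > ⋯ > n_d > 0} z₁^{n₁} ⋯ z_d^{n_d} / (n₁^{k₁} ⋯ n_d^{k_d})`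
attached to the list `[(k₁, z₁), …, (k_d, z_d)]`; it is `1` for the empty list. -/
noncomputable def polylogPartialSum : List (ℕ × ℂ) → ℕ → ℂ
  | [], _ => 1
  | (k, z) :: s, M => ∑ n ∈ Finset.Icc 1 M, z ^ n / (n : ℂ) ^ k * polylogPartialSum s (n - 1)

/-- The multiple polylogarithm `Li_{k₁,…,k_d}(z₁,…,z_d)`, attached to the list
`[(k₁, z₁), …, (k_d, z_d)]`: the limit of the truncated sums (meaningful when it exists). -/
noncomputable def multiplePolylog (s : List (ℕ × ℂ)) : ℂ :=
  limUnder atTop (polylogPartialSum s)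

/-- `s = [(k₁, η₁), …, (k_d, η_d)]` is the index of a colored multiple zeta value of level `N` and
weight `w`: the `kᵢ` are positive integers with sum `w`, the `ηᵢ` are `N`-th roots of unity
(not necessarily primitive), and the defining series is not the divergent case
`(k₁, η₁) = (1, 1)`. -/
def IsCMZVIndex (N w : ℕ) (s : List (ℕ × ℂ)) : Prop :=
  (∀ p ∈ s, 0 < p.1 ∧ p.2 ^ N = 1) ∧ s.head? ≠ some (1, 1) ∧ (s.map Prod.fst).sum = w

/-- The `ℚ`-span in `ℂ` of all colored multiple zeta values of weight `w` and level `N`, i.e. of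
all sums of convergent series `Li_{k₁,…,k_d}(η₁,…,η_d)` with `(kᵢ, ηᵢ)` as in `IsCMZVIndex`. -/
noncomputable def CMZV (N w : ℕ) : Submodule ℚ ℂ :=
  Submodule.span ℚ
    {v : ℂ | ∃ s : List (ℕ × ℂ), IsCMZVIndex N w s ∧ Tendsto (polylogPartialSum s) atTop (𝓝 v)}

/-! Put c = cos θ, q = x² - 2cx + 1, v = 2x/q and u = (1 - c)v. The numbers F_n are moments, F_n =
∫₀¹ vⁿ dx/x: both satisfy the same recurrence with the same initial values
(`eq_kernelMoment_of_recurrence`). Since H_{n-1}(k)/n^l are the Taylor coefficients of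
Li_{l,k}(u,1,…,1), the series equals ∫₀¹ Li_{l,k}(u(x),1,…,1) dx/x (`hasSum_mul_kernelMoment`).

With ν the conjugate of μ, q = (1 - μx)(1 - νx) and 1 - u = (1 - x)²/q. Hence the two forms that
generate these polylogarithms pull back to du/u = dx/x + μ dx/(1 - μx) + ν dx/(1 - νx), du/(1 - u) =
2 dx/(1 - x) - μ dx/(1 - μx) - ν dx/(1 - νx), whose poles are 0 and N-th roots of unity. So
Li_{l,k}(u(x),1,…,1) is a rational combination of polylogarithms in x at N-th roots of unity of the
same weight (`exists_transfers`). The last integration ∫₀¹ dx/x raises the weight by one and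
evaluates at x = 1 (`hasSum_intZero_mem_CMZV`).

Iterated integrals are handled on Taylor coefficients: `intZero` and `intRoot` represent integration
against dx/x and η dx/(1 - ηx). -/

/-! ### The kernel v, its moments, and their three-term recurrence -/

lemma quad_pos {c x : ℝ} (hc : c < 1) (hx : 0 ≤ x) : 0 < x ^ 2 - 2 * c * x + 1 := by
  have h : x ^ 2 - 2 * c * x + 1 = (1 - x) ^ 2 + 2 * (1 - c) * x := by ring
  rw [h]
  rcases hx.eq_or_lt with rfl | hx
  · norm_num
  · have := mul_pos (sub_pos.2 hc) hx
    nlinarith [sq_nonneg (1 - x)]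

/-- The function `v(x) = 2x / (x² - 2cx + 1)`. -/
noncomputable def quadKernel (c x : ℝ) : ℝ := 2 * x / (x ^ 2 - 2 * c * x + 1)

lemma hasDerivAt_quad (c x : ℝ) :
    HasDerivAt (fun x : ℝ => x ^ 2 - 2 * c * x + 1) (2 * x - 2 * c) x := by
  have := (((hasDerivAt_id x).pow 2).sub ((hasDerivAt_id x).const_mul (2 * c))).add_const 1
  refine this.congr_deriv ?_
  simp

lemma hasDerivAt_quadKernel {c x : ℝ} (hc : c < 1) (hx : 0 ≤ x) :
    HasDerivAt (quadKernel c) (2 * (1 - x ^ 2) / (x ^ 2 - 2 * c * x + 1) ^ 2) x := by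
  have hq := (quad_pos hc hx).ne'
  have := ((hasDerivAt_id x).const_mul 2).div (hasDerivAt_quad c x) hq
  refine this.congr_deriv ?_
  simp only [id]
  congr 1
  ring

/-- The ratio R = (1 - x²)/q is x v'/v. It equals 1 at x = 0 and 0 at x = 1, which makes it the
right factor for the integrations by parts below. -/
lemma hasDerivAt_quadRatio {c x : ℝ} (hc : c < 1) (hx : 0 ≤ x) :
    HasDerivAt (fun x => (1 - x ^ 2) / (x ^ 2 - 2 * c * x + 1))
      ((c - (1 - c ^ 2) * quadKernel c x) * (2 / (x ^ 2 - 2 * c * x + 1))) x := by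
  have hq := (quad_pos hc hx).ne'
  have := (((hasDerivAt_id x).pow 2).const_sub 1).div (hasDerivAt_quad c x) hq
  refine this.congr_deriv ?_
  simp only [id, quadKernel, Pi.pow_apply]
  generalize hq' : x ^ 2 - 2 * c * x + 1 = q at *
  field_simp
  rw [← hq']
  simp only [Nat.cast_ofNat]
  ring

lemma continuousOn_quadKernel {c : ℝ} (hc : c < 1) :
    ContinuousOn (quadKernel c) (Set.Icc 0 1) := fun _ hx =>
  (hasDerivAt_quadKernel hc hx.1).continuousAt.continuousWithinAt

lemma continuousOn_two_div_quad {c : ℝ} (hc : c < 1) :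
    ContinuousOn (fun x : ℝ => 2 / (x ^ 2 - 2 * c * x + 1)) (Set.Icc 0 1) :=
  continuousOn_const.div (by fun_prop) fun _ hx => (quad_pos hc hx.1).ne'

/-- The moments `∫₀¹ v(x)ⁿ⁺¹ dx/x` of the kernel `v(x) = 2x / (x² - 2cx + 1)`. -/
noncomputable def kernelMoment (c : ℝ) (n : ℕ) : ℝ :=
  ∫ x in (0 : ℝ)..1, quadKernel c x ^ n * (2 / (x ^ 2 - 2 * c * x + 1))

lemma intervalIntegrable_kernelMoment {c : ℝ} (hc : c < 1) (n : ℕ) :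
    IntervalIntegrable (fun x => quadKernel c x ^ n * (2 / (x ^ 2 - 2 * c * x + 1)))
      MeasureTheory.volume 0 1 := by
  apply ContinuousOn.intervalIntegrable
  rw [Set.uIcc_of_le zero_le_one]
  exact ((continuousOn_quadKernel hc).pow n).mul (continuousOn_two_div_quad hc)

/-- Integrate R' over [0, 1]; the boundary term is R(1) - R(0) = -1. -/
lemma kernelMoment_one {c : ℝ} (hc : c < 1) :
    (1 - c ^ 2) * kernelMoment c 1 = c * kernelMoment c 0 + 1 := by
  have h := intervalIntegral.integral_eq_sub_of_hasDerivAt (a := 0) (b := 1)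
    (f := fun x => (1 - x ^ 2) / (x ^ 2 - 2 * c * x + 1))
    (f' := fun x => c * (quadKernel c x ^ 0 * (2 / (x ^ 2 - 2 * c * x + 1)))
      - (1 - c ^ 2) * (quadKernel c x ^ 1 * (2 / (x ^ 2 - 2 * c * x + 1))))
    (fun x hx => by
      rw [Set.uIcc_of_le zero_le_one] at hx
      refine (hasDerivAt_quadRatio hc hx.1).congr_deriv ?_
      ring)
    (((intervalIntegrable_kernelMoment hc 0).const_mul _).sub
      ((intervalIntegrable_kernelMoment hc 1).const_mul _))
  rw [intervalIntegral.integral_sub ((intervalIntegrable_kernelMoment hc 0).const_mul _)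
      ((intervalIntegrable_kernelMoment hc 1).const_mul _),
    intervalIntegral.integral_const_mul, intervalIntegral.integral_const_mul] at h
  norm_num at h
  unfold kernelMoment
  norm_num
  linarith

/-- Integrate the derivative of v^(m+1) R: both boundary terms vanish, because v(0) = 0 and R(1) =
0. -/
lemma kernelMoment_add_two {c : ℝ} (hc : c < 1) (m : ℕ) :
    (m + 2 : ℝ) * (1 - c ^ 2) * kernelMoment c (m + 2)
      = (2 * m + 3) * c * kernelMoment c (m + 1) + (m + 1) * kernelMoment c m := by
  have hi := intervalIntegrable_kernelMoment hc
  have h := intervalIntegral.integral_eq_sub_of_hasDerivAt (a := 0) (b := 1)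
    (f := fun x => quadKernel c x ^ (m + 1) * ((1 - x ^ 2) / (x ^ 2 - 2 * c * x + 1)))
    (f' := fun x => (m + 1 : ℝ) * (quadKernel c x ^ m * (2 / (x ^ 2 - 2 * c * x + 1)))
      + ((2 * m + 3) * c) * (quadKernel c x ^ (m + 1) * (2 / (x ^ 2 - 2 * c * x + 1)))
      - ((m + 2) * (1 - c ^ 2)) * (quadKernel c x ^ (m + 2) * (2 / (x ^ 2 - 2 * c * x + 1))))
    (fun x hx => by
      rw [Set.uIcc_of_le zero_le_one] at hx
      have hq := (quad_pos hc hx.1).ne'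
      refine (((hasDerivAt_quadKernel hc hx.1).pow (m + 1)).mul
        (hasDerivAt_quadRatio hc hx.1)).congr_deriv ?_
      simp only [Pi.pow_apply, Nat.add_sub_cancel]
      -- This is v'R = R² · 2/q, with R² = 1 + 2cv - (1 - c²)v² a polynomial in v.
      have e : (2 * (1 - x ^ 2) / (x ^ 2 - 2 * c * x + 1) ^ 2)
            * ((1 - x ^ 2) / (x ^ 2 - 2 * c * x + 1))
          = (1 + 2 * c * quadKernel c x - (1 - c ^ 2) * quadKernel c x ^ 2)
            * (2 / (x ^ 2 - 2 * c * x + 1)) := by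
        simp only [quadKernel]
        generalize hq' : x ^ 2 - 2 * c * x + 1 = q at *
        field_simp
        rw [← hq']
        ring
      push_cast
      linear_combination ((m : ℝ) + 1) * quadKernel c x ^ m * e)
    ((((hi m).const_mul _).add ((hi (m + 1)).const_mul _)).sub ((hi (m + 2)).const_mul _))
  rw [intervalIntegral.integral_sub (((hi m).const_mul _).add ((hi (m + 1)).const_mul _))
      ((hi (m + 2)).const_mul _),
    intervalIntegral.integral_add ((hi m).const_mul _) ((hi (m + 1)).const_mul _),
    intervalIntegral.integral_const_mul, intervalIntegral.integral_const_mul,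
    intervalIntegral.integral_const_mul] at h
  have h0 : quadKernel c 0 = 0 := by simp [quadKernel]
  simp only [h0] at h
  norm_num at h
  unfold kernelMoment
  linarith

lemma kernelMoment_neg_one_zero : kernelMoment (-1) 0 = 1 := by
  have h := intervalIntegral.integral_eq_sub_of_hasDerivAt (a := 0) (b := 1)
    (f := fun x : ℝ => -2 / (x + 1))
    (f' := fun x => quadKernel (-1) x ^ 0 * (2 / (x ^ 2 - 2 * (-1) * x + 1)))
    (fun x hx => by
      rw [Set.uIcc_of_le zero_le_one] at hx
      have hx1 : x + 1 ≠ 0 := by linarith [hx.1]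
      have hq : x ^ 2 - 2 * (-1) * x + 1 = (x + 1) ^ 2 := by ring
      refine ((hasDerivAt_const x (-2 : ℝ)).div ((hasDerivAt_id x).add_const 1) hx1).congr_deriv ?_
      rw [hq]
      simp)
    (intervalIntegrable_kernelMoment (by norm_num) 0)
  rw [kernelMoment, h]
  norm_num

lemma kernelMoment_cos_zero {θ : ℝ} (h0 : 0 < θ) (hπ : θ < Real.pi) :
    kernelMoment (Real.cos θ) 0 = (Real.pi - θ) / Real.sin θ := by
  have hs := Real.sin_pos_of_pos_of_lt_pi h0 hπ
  have hc : Real.cos θ < 1 := by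
    have h1 := Real.sin_sq_add_cos_sq θ
    nlinarith
  have h := intervalIntegral.integral_eq_sub_of_hasDerivAt (a := 0) (b := 1)
    (f := fun x : ℝ => 2 / Real.sin θ * Real.arctan ((x - Real.cos θ) / Real.sin θ))
    (f' := fun x => quadKernel (Real.cos θ) x ^ 0 * (2 / (x ^ 2 - 2 * Real.cos θ * x + 1)))
    (fun x hx => by
      rw [Set.uIcc_of_le zero_le_one] at hx
      have hq := (quad_pos hc hx.1).ne'
      refine ((((hasDerivAt_id x).sub_const (Real.cos θ)).div_const
        (Real.sin θ)).arctan.const_mul (2 / Real.sin θ)).congr_deriv ?_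
      simp only [id]
      have e : 1 + ((x - Real.cos θ) / Real.sin θ) ^ 2
          = (x ^ 2 - 2 * Real.cos θ * x + 1) / Real.sin θ ^ 2 := by
        field_simp
        linear_combination Real.sin_sq_add_cos_sq θ
      rw [e]
      field_simp)
    (intervalIntegrable_kernelMoment hc 0)
  rw [kernelMoment, h]
  -- The endpoint values of the arctangent are θ/2 and θ - π/2; their difference is (π - θ)/2.
  have e1 : Real.arctan ((1 - Real.cos θ) / Real.sin θ) = θ / 2 := by
    have ht : (1 - Real.cos θ) / Real.sin θ = Real.tan (θ / 2) := by
      have hh : θ = 2 * (θ / 2) := by ring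
      have hc2 : 0 < Real.cos (θ / 2) :=
        Real.cos_pos_of_mem_Ioo ⟨by linarith, by linarith⟩
      have hs2 : 0 < Real.sin (θ / 2) := Real.sin_pos_of_pos_of_lt_pi (by linarith) (by linarith)
      rw [Real.tan_eq_sin_div_cos]
      conv_lhs => rw [hh, Real.cos_two_mul, Real.sin_two_mul]
      field_simp
      linear_combination -2 * Real.sin_sq_add_cos_sq (θ / 2)
    rw [ht, Real.arctan_tan (by linarith) (by linarith)]
  have e2 : Real.arctan ((0 - Real.cos θ) / Real.sin θ) = θ - Real.pi / 2 := by
    have ht : (0 - Real.cos θ) / Real.sin θ = Real.tan (θ - Real.pi / 2) := by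
      rw [Real.tan_eq_sin_div_cos, Real.sin_sub_pi_div_two, Real.cos_sub_pi_div_two, zero_sub]
    rw [ht, Real.arctan_tan (by linarith) (by linarith)]
  rw [e1, e2]
  field_simp
  ring

/-- The solution of the three-term recurrence is given by the moments of the kernel. -/
lemma eq_kernelMoment_of_recurrence {c : ℝ} (hc : c < 1) {F : ℕ → ℝ}
    (hF1 : F 1 = kernelMoment c 0) (hF2 : F 2 = kernelMoment c 1)
    (hF : ∀ n : ℕ, 2 ≤ n →
      (n : ℝ) * (1 - c ^ 2) * F (n + 1) - (2 * (n : ℝ) - 1) * c * F n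
        - ((n : ℝ) - 1) * F (n - 1) = 0) (hc1 : -1 ≤ c) (n : ℕ) :
    F (n + 1) = kernelMoment c n := by
  suffices h : F (n + 1) = kernelMoment c n ∧ F (n + 2) = kernelMoment c (n + 1) from h.1
  induction n with
  | zero => exact ⟨hF1, hF2⟩
  | succ n ih =>
    obtain ⟨h1, h2⟩ := ih
    refine ⟨h2, ?_⟩
    rcases hc1.eq_or_lt with rfl | hc1
    -- At c = -1 the leading coefficient 1 - c² vanishes, so the recurrence has order one and must
    -- be used one index later to determine the required term.
    · have h3 := hF (n + 1 + 2) (by lia)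
      have h4 := kernelMoment_add_two hc (n + 1)
      simp only [show n + 1 + 2 - 1 = n + 2 from rfl] at h3
      push_cast at h3 h4
      rw [h2] at h3
      have hn : (2 * (n : ℝ) + 5) ≠ 0 := by positivity
      apply mul_left_cancel₀ hn
      rw [show n + 1 + 2 = n + 3 from rfl] at *
      rw [show n + 1 + 1 = n + 2 from rfl] at *
      linear_combination h3 - h4
    · have h3 := hF (n + 2) (by lia)
      have h4 := kernelMoment_add_two hc n
      simp only [show n + 2 - 1 = n + 1 from rfl] at h3
      push_cast at h3
      rw [h1, h2] at h3
      have hn : ((n : ℝ) + 2) * (1 - c ^ 2) ≠ 0 := by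
        have : 0 < 1 - c ^ 2 := by nlinarith
        positivity
      apply mul_left_cancel₀ hn
      linear_combination h3 - h4

/-! ### Integration operators on Taylor coefficients -/

/-- The power series coefficients of the multiple polylogarithm attached to a list, as a function
of an extra variable recording the outermost summation index. -/
noncomputable def polylogCoeff : List (ℕ × ℂ) → ℕ → ℂ
  | [], n => if n = 0 then 1 else 0
  | (k, z) :: s, n => if n = 0 then 0 else z ^ n / (n : ℂ) ^ k * polylogPartialSum s (n - 1)

lemma sum_range_polylogCoeff (s : List (ℕ × ℂ)) (M : ℕ) :
    ∑ m ∈ Finset.range (M + 1), polylogCoeff s m = polylogPartialSum s M := by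
  rcases s with _ | ⟨⟨k, z⟩, s⟩
  · simp [polylogCoeff, polylogPartialSum]
  · rw [polylogPartialSum, Finset.sum_range_succ', Finset.range_eq_Ico,
      Finset.sum_Ico_add' (fun m => polylogCoeff ((k, z) :: s) m) 0 M 1]
    simp only [polylogCoeff, if_true, add_zero, zero_add]
    refine Finset.sum_congr rfl fun n hn => ?_
    rw [if_neg (by have := (Finset.mem_Ico.1 hn).1; lia)]

/-- Coefficientwise form of the operator `f ↦ ∫ f dx/x`. -/
noncomputable def intZero : (ℕ → ℂ) →ₗ[ℚ] (ℕ → ℂ) where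
  toFun f n := f n / n
  map_add' f g := by ext n; simp [add_div]
  map_smul' a f := by ext n; simp [smul_div_assoc]

/-- Coefficientwise form of the operator `f ↦ ∫ f η dx/(1 - η x)`. -/
noncomputable def intRoot (η : ℂ) : (ℕ → ℂ) →ₗ[ℚ] (ℕ → ℂ) where
  toFun f n := (∑ m ∈ Finset.range n, f m * η ^ (n - m)) / n
  map_add' f g := by ext n; simp [add_mul, Finset.sum_add_distrib, add_div]
  map_smul' a f := by
    ext n
    simp only [Pi.smul_apply, smul_mul_assoc, ← Finset.smul_sum, smul_div_assoc, RingHom.id_apply]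

lemma intZero_apply (f : ℕ → ℂ) (n : ℕ) : intZero f n = f n / n := rfl

lemma intRoot_apply (η : ℂ) (f : ℕ → ℂ) (n : ℕ) :
    intRoot η f n = (∑ m ∈ Finset.range n, f m * η ^ (n - m)) / n := rfl

lemma intZero_polylogCoeff (k : ℕ) (z : ℂ) (s : List (ℕ × ℂ)) :
    intZero (polylogCoeff ((k, z) :: s)) = polylogCoeff ((k + 1, z) :: s) := by
  ext n
  rcases eq_or_ne n 0 with rfl | hn
  · simp [intZero_apply, polylogCoeff]
  · have : (n : ℂ) ≠ 0 := Nat.cast_ne_zero.2 hn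
    simp only [intZero_apply, polylogCoeff, if_neg hn]
    field_simp
    ring

lemma intRoot_polylogCoeff_nil (η : ℂ) :
    intRoot η (polylogCoeff []) = polylogCoeff [(1, η)] := by
  ext n
  rcases n with _ | n
  · simp [intRoot_apply, polylogCoeff]
  · rw [intRoot_apply, Finset.sum_range_succ']
    simp [polylogCoeff, polylogPartialSum]

/-- Since z^m η^(n-m) = η^n (zη⁻¹)^m, a new outer index with root η appears and the former head is
twisted by η⁻¹. -/
lemma intRoot_polylogCoeff_cons {η : ℂ} (hη : η ≠ 0) (k : ℕ) (z : ℂ) (s : List (ℕ × ℂ)) :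
    intRoot η (polylogCoeff ((k, z) :: s)) = polylogCoeff ((1, η) :: (k, z * η⁻¹) :: s) := by
  ext n
  rcases n with _ | n
  · simp [intRoot_apply, polylogCoeff]
  · rw [intRoot_apply, polylogCoeff, if_neg n.succ_ne_zero, Nat.add_sub_cancel,
      ← sum_range_polylogCoeff, pow_one, div_mul_eq_mul_div, Finset.mul_sum]
    congr 1
    refine Finset.sum_congr rfl fun m hm => ?_
    have hm : m ≤ n + 1 := (Finset.mem_range.1 hm).le
    simp only [polylogCoeff]
    split_ifs
    · simp
    · rw [pow_sub₀ η hη hm, mul_pow, inv_pow]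
      ring

/-! ### A decay class stable under integration -/

/-- Decay of order `n ^ (-1/2)`. -/
def SqrtDecay (f : ℕ → ℂ) : Prop := ∃ C : ℝ, ∀ n : ℕ, ‖f n‖ ≤ C / √(n + 1)

namespace SqrtDecay

lemma add {f g : ℕ → ℂ} (hf : SqrtDecay f) (hg : SqrtDecay g) : SqrtDecay (f + g) := by
  obtain ⟨C, hC⟩ := hf
  obtain ⟨D, hD⟩ := hg
  refine ⟨C + D, fun n => (norm_add_le _ _).trans ?_⟩
  rw [add_div]
  exact add_le_add (hC n) (hD n)

lemma neg {f : ℕ → ℂ} (hf : SqrtDecay f) : SqrtDecay (-f) := by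
  obtain ⟨C, hC⟩ := hf
  exact ⟨C, fun n => by simpa using hC n⟩

lemma sub {f g : ℕ → ℂ} (hf : SqrtDecay f) (hg : SqrtDecay g) : SqrtDecay (f - g) := by
  rw [sub_eq_add_neg]
  exact hf.add hg.neg

lemma exists_bound {f : ℕ → ℂ} (hf : SqrtDecay f) : ∃ C : ℝ, ∀ n, ‖f n‖ ≤ C := by
  obtain ⟨C, hC⟩ := hf
  have hC0 : 0 ≤ C := by simpa using (norm_nonneg _).trans (hC 0)
  refine ⟨C, fun n => (hC n).trans (div_le_self hC0 ?_)⟩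
  rw [Real.one_le_sqrt]
  linarith [n.cast_nonneg (α := ℝ)]

lemma polylogCoeff_nil : SqrtDecay (polylogCoeff []) := by
  refine ⟨1, fun n => ?_⟩
  rcases eq_or_ne n 0 with rfl | hn
  · simp [polylogCoeff]
  · simp only [polylogCoeff, if_neg hn, norm_zero]
    positivity

lemma intZero {f : ℕ → ℂ} (hf : SqrtDecay f) : SqrtDecay (intZero f) := by
  obtain ⟨C, hC⟩ := hf
  refine ⟨C, fun n => le_trans ?_ (hC n)⟩
  rw [intZero_apply, norm_div, Complex.norm_natCast]
  rcases eq_or_ne n 0 with rfl | hn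
  · simp
  · exact div_le_self (norm_nonneg _) (by exact_mod_cast Nat.one_le_iff_ne_zero.2 hn)

lemma _root_.sum_range_one_div_sqrt_le (n : ℕ) :
    ∑ m ∈ Finset.range n, 1 / √((m : ℝ) + 1) ≤ 2 * √n := by
  induction n with
  | zero => simp
  | succ n ih =>
    rw [Finset.sum_range_succ]
    push_cast
    have h1 : 0 < √((n : ℝ) + 1) := Real.sqrt_pos.2 (by positivity)
    have h2 := Real.sq_sqrt (show (0 : ℝ) ≤ n + 1 by positivity)
    have h3 := Real.sq_sqrt (show (0 : ℝ) ≤ n by positivity)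
    have h4 : 1 / √((n : ℝ) + 1) ≤ 2 * (√((n : ℝ) + 1) - √n) := by
      rw [div_le_iff₀ h1]
      nlinarith [sq_nonneg (√((n : ℝ) + 1) - √n)]
    linarith

/-- The sum of m^(-1/2) up to n is O(√n), and division by n restores n^(-1/2). The exponent 1/2 thus
absorbs the powers of log n that repeated integration creates. -/
lemma intRoot {f : ℕ → ℂ} (hf : SqrtDecay f) {η : ℂ} (hη : ‖η‖ = 1) :
    SqrtDecay (intRoot η f) := by
  obtain ⟨C, hC⟩ := hf
  have hC0 : 0 ≤ C := by simpa using (norm_nonneg _).trans (hC 0)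
  refine ⟨4 * C, fun n => ?_⟩
  rcases eq_or_ne n 0 with rfl | hn
  · simp [intRoot_apply, hC0]
  have hn1 : (1 : ℝ) ≤ n := by exact_mod_cast Nat.one_le_iff_ne_zero.2 hn
  have h : ‖∑ m ∈ Finset.range n, f m * η ^ (n - m)‖ ≤ C * (2 * √n) := by
    refine (norm_sum_le _ _).trans (le_trans ?_
      (mul_le_mul_of_nonneg_left (sum_range_one_div_sqrt_le n) hC0))
    rw [Finset.mul_sum]
    refine Finset.sum_le_sum fun m _ => ?_
    rw [norm_mul, norm_pow, hη, one_pow, mul_one, mul_one_div]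
    exact hC m
  rw [intRoot_apply, norm_div, Complex.norm_natCast]
  have h1 : 0 < √(n : ℝ) := Real.sqrt_pos.2 (by linarith)
  have h2 : √((n : ℝ) + 1) ≤ 2 * √n := by
    rw [Real.sqrt_le_left (by positivity), mul_pow, Real.sq_sqrt (by positivity)]
    linarith
  have h3 := Real.mul_self_sqrt (show (0 : ℝ) ≤ n by positivity)
  rw [div_le_div_iff₀ (by positivity) (by positivity)]
  calc _ ≤ C * (2 * √n) * (2 * √n) := by gcongr
    _ = 4 * C * n := by linear_combination 4 * C * h3

lemma summable_intZero {f : ℕ → ℂ} (hf : SqrtDecay f) : Summable fun n => ‖_root_.intZero f n‖ := by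
  obtain ⟨C, hC⟩ := hf
  have hC0 : 0 ≤ C := by simpa using (norm_nonneg _).trans (hC 0)
  have hs : Summable fun n : ℕ => C * (1 / (n : ℝ) ^ (3 / 2 : ℝ)) :=
    (Real.summable_one_div_nat_rpow.2 (by norm_num)).mul_left C
  refine Summable.of_nonneg_of_le (fun _ => norm_nonneg _) (fun n => ?_) hs
  rcases eq_or_ne n 0 with rfl | hn
  · simp [intZero_apply]
  have hn0 : (0 : ℝ) < n := by exact_mod_cast Nat.pos_of_ne_zero hn
  rw [intZero_apply, norm_div, Complex.norm_natCast, mul_one_div,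
    show (3 / 2 : ℝ) = 1 / 2 + 1 by norm_num, Real.rpow_add hn0, Real.rpow_one, ← div_div,
    ← Real.sqrt_eq_rpow]
  gcongr
  refine (hC n).trans ?_
  gcongr
  linarith

lemma polylogCoeff {s : List (ℕ × ℂ)} (hs : ∀ p ∈ s, 0 < p.1 ∧ ‖p.2‖ = 1) :
    SqrtDecay (polylogCoeff s) := by
  induction hl : (s.map Prod.fst).sum using Nat.strong_induction_on generalizing s with
  | _ w ih =>
    rcases s with _ | ⟨⟨k, z⟩, s⟩
    · exact polylogCoeff_nil
    · obtain ⟨hk, hz⟩ := hs _ List.mem_cons_self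
      simp only at hk hz
      have hs' : ∀ p ∈ s, 0 < p.1 ∧ ‖p.2‖ = 1 := fun p hp => hs p (List.mem_cons_of_mem _ hp)
      obtain ⟨k, rfl⟩ : ∃ k', k = k' + 1 := ⟨k - 1, by lia⟩
      have hz0 : z ≠ 0 := norm_ne_zero_iff.1 (by rw [hz]; exact one_ne_zero)
      simp only [List.map_cons, List.sum_cons] at hl
      rcases eq_or_ne k 0 with rfl | hk0
      · rcases s with _ | ⟨⟨k', z'⟩, s⟩
        · rw [zero_add, ← intRoot_polylogCoeff_nil]
          exact polylogCoeff_nil.intRoot hz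
        -- The next head is taken to be z'z, so that the twist by z⁻¹ returns z'.
        · have e := intRoot_polylogCoeff_cons hz0 k' (z' * z) s
          rw [mul_assoc, mul_inv_cancel₀ hz0, mul_one] at e
          rw [zero_add, ← e]
          obtain ⟨hk', hz'⟩ := hs' _ List.mem_cons_self
          simp only at hk' hz'
          refine (ih _ ?_ ?_ rfl).intRoot hz
          · simp only [List.map_cons, List.sum_cons] at hl ⊢
            lia
          · intro p hp
            rcases List.mem_cons.1 hp with rfl | hp
            · exact ⟨hk', by simp [hz, hz']⟩
            · exact hs' p (List.mem_cons_of_mem _ hp)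
      · rw [← intZero_polylogCoeff]
        refine (ih _ ?_ ?_ rfl).intZero
        · simp only [List.map_cons, List.sum_cons]
          lia
        · intro p hp
          rcases List.mem_cons.1 hp with rfl | hp
          · exact ⟨by simpa using Nat.pos_of_ne_zero hk0, hz⟩
          · exact hs' p hp

end SqrtDecay

/-! ### Rational spans and values at x = 1 -/

/-- The `ℚ`-span of the coefficient sequences of the multiple polylogarithms of weight `w` at
`N`-th roots of unity. -/
noncomputable def coeffSpan (N w : ℕ) : Submodule ℚ (ℕ → ℂ) :=
  Submodule.span ℚ {f | ∃ s : List (ℕ × ℂ), (∀ p ∈ s, 0 < p.1 ∧ p.2 ^ N = 1) ∧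
    (s.map Prod.fst).sum = w ∧ f = polylogCoeff s}

lemma polylogCoeff_nil_mem (N : ℕ) : polylogCoeff [] ∈ coeffSpan N 0 :=
  Submodule.subset_span ⟨[], by simp⟩

lemma intZero_mem {N w : ℕ} (hw : 0 < w) {f : ℕ → ℂ} (hf : f ∈ coeffSpan N w) :
    intZero f ∈ coeffSpan N (w + 1) := by
  suffices h : coeffSpan N w ≤ (coeffSpan N (w + 1)).comap intZero from h hf
  refine Submodule.span_le.2 ?_
  rintro _ ⟨_ | ⟨⟨k, z⟩, s⟩, hs, hsw, rfl⟩
  · simp at hsw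
    lia
  · rw [SetLike.mem_coe, Submodule.mem_comap, intZero_polylogCoeff]
    refine Submodule.subset_span ⟨_, ?_, ?_, rfl⟩
    · intro p hp
      rcases List.mem_cons.1 hp with rfl | hp
      · exact ⟨Nat.succ_pos _, (hs _ List.mem_cons_self).2⟩
      · exact hs p (List.mem_cons_of_mem _ hp)
    · simp only [List.map_cons, List.sum_cons] at hsw ⊢
      lia

lemma intRoot_mem {N w : ℕ} (hN : N ≠ 0) {η : ℂ} (hη : η ^ N = 1) {f : ℕ → ℂ}
    (hf : f ∈ coeffSpan N w) : intRoot η f ∈ coeffSpan N (w + 1) := by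
  have hη0 : η ≠ 0 := by
    rintro rfl
    simp [hN] at hη
  suffices h : coeffSpan N w ≤ (coeffSpan N (w + 1)).comap (intRoot η) from h hf
  refine Submodule.span_le.2 ?_
  rintro _ ⟨_ | ⟨⟨k, z⟩, s⟩, hs, hsw, rfl⟩
  · rw [SetLike.mem_coe, Submodule.mem_comap, intRoot_polylogCoeff_nil]
    refine Submodule.subset_span ⟨_, ?_, ?_, rfl⟩
    · simpa using hη
    · simp at hsw ⊢
      lia
  · rw [SetLike.mem_coe, Submodule.mem_comap, intRoot_polylogCoeff_cons hη0]
    refine Submodule.subset_span ⟨_, ?_, ?_, rfl⟩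
    · intro p hp
      rcases List.mem_cons.1 hp with rfl | hp
      · exact ⟨one_pos, hη⟩
      rcases List.mem_cons.1 hp with rfl | hp
      · obtain ⟨h1, h2⟩ := hs _ List.mem_cons_self
        exact ⟨h1, by simp only at h2; simp [mul_pow, hη, h2]⟩
      · exact hs p (List.mem_cons_of_mem _ hp)
    · simp only [List.map_cons, List.sum_cons] at hsw ⊢
      lia

lemma hasSum_intZero_polylogCoeff {k : ℕ} {z : ℂ} {s : List (ℕ × ℂ)} (hk : 0 < k)
    (hz : ‖z‖ = 1) (hs : ∀ p ∈ s, 0 < p.1 ∧ ‖p.2‖ = 1) :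
    HasSum (intZero (polylogCoeff ((k, z) :: s))) (multiplePolylog ((k + 1, z) :: s)) ∧
      Tendsto (polylogPartialSum ((k + 1, z) :: s)) atTop
        (𝓝 (multiplePolylog ((k + 1, z) :: s))) := by
  have hd : SqrtDecay (polylogCoeff ((k, z) :: s)) := by
    refine SqrtDecay.polylogCoeff fun p hp => ?_
    rcases List.mem_cons.1 hp with rfl | hp
    · exact ⟨hk, hz⟩
    · exact hs p hp
  have hsum := hd.summable_intZero.of_norm.hasSum
  have ht : Tendsto (polylogPartialSum ((k + 1, z) :: s)) atTop
      (𝓝 (∑' n, intZero (polylogCoeff ((k, z) :: s)) n)) := by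
    have h := hsum.tendsto_sum_nat.comp (tendsto_add_atTop_nat 1)
    refine h.congr fun M => ?_
    rw [Function.comp_apply, intZero_polylogCoeff, sum_range_polylogCoeff]
  have e : multiplePolylog ((k + 1, z) :: s) = ∑' n, intZero (polylogCoeff ((k, z) :: s)) n :=
    ht.limUnder_eq
  rw [e]
  exact ⟨hsum, ht⟩

lemma hasSum_intZero_mem_CMZV {N w : ℕ} (hN : N ≠ 0) (hw : 0 < w) {f : ℕ → ℂ}
    (hf : f ∈ coeffSpan N w) : ∃ v ∈ CMZV N (w + 1), HasSum (intZero f) v := by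
  induction hf using Submodule.span_induction with
  | mem f h =>
    obtain ⟨_ | ⟨⟨k, z⟩, s⟩, hs, hsw, rfl⟩ := h
    · simp at hsw
      lia
    obtain ⟨hk, hz⟩ := hs _ List.mem_cons_self
    have hs' : ∀ p ∈ s, 0 < p.1 ∧ p.2 ^ N = 1 := fun p hp => hs p (List.mem_cons_of_mem _ hp)
    obtain ⟨h1, h2⟩ := hasSum_intZero_polylogCoeff hk (Complex.norm_eq_one_of_pow_eq_one hz hN)
      fun p hp => ⟨(hs' p hp).1, Complex.norm_eq_one_of_pow_eq_one (hs' p hp).2 hN⟩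
    refine ⟨_, Submodule.subset_span ⟨_, ⟨?_, ?_, ?_⟩, h2⟩, h1⟩
    · intro p hp
      rcases List.mem_cons.1 hp with rfl | hp
      · exact ⟨Nat.succ_pos _, hz⟩
      · exact hs' p hp
    -- The last dx/x makes the leading exponent at least 2, so the excluded head (1, 1) cannot
    -- occur.
    · simp only [List.head?_cons, ne_eq, Option.some.injEq, Prod.mk.injEq]
      simp only at hk
      lia
    · simp only [List.map_cons, List.sum_cons] at hsw ⊢
      lia
  | zero => exact ⟨0, Submodule.zero_mem _, by rw [map_zero]; exact hasSum_zero⟩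
  | add f g _ _ hf hg =>
    obtain ⟨v, hv, hv'⟩ := hf
    obtain ⟨u, hu, hu'⟩ := hg
    exact ⟨v + u, Submodule.add_mem _ hv hu, by rw [map_add]; exact hv'.add hu'⟩
  | smul a f _ hf =>
    obtain ⟨v, hv, hv'⟩ := hf
    refine ⟨a • v, Submodule.smul_mem _ _ hv, ?_⟩
    rw [map_smul]
    exact hv'.const_smul a

/-! ### Generating functions and their derivatives -/

/-- The power series with coefficients `f`, as a function of a real variable. -/
noncomputable def genFun (f : ℕ → ℂ) (x : ℝ) : ℂ := ∑' n, f n * (x : ℂ) ^ n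

lemma summable_genFun {f : ℕ → ℂ} {C : ℝ} (hf : ∀ n, ‖f n‖ ≤ C) {x : ℝ} (hx : |x| < 1) :
    Summable fun n => f n * (x : ℂ) ^ n := by
  refine Summable.of_norm_bounded
    ((summable_geometric_of_lt_one (abs_nonneg x) hx).mul_left C) fun n => ?_
  rw [norm_mul, norm_pow, Complex.norm_real, Real.norm_eq_abs]
  exact mul_le_mul_of_nonneg_right (hf n) (by positivity)

lemma genFun_zero (f : ℕ → ℂ) : genFun f 0 = f 0 := by
  rw [genFun, tsum_eq_single 0]
  · simp
  · intro n hn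
    simp [hn]

lemma genFun_add {f g : ℕ → ℂ} {x : ℝ} (hf : Summable fun n => f n * (x : ℂ) ^ n)
    (hg : Summable fun n => g n * (x : ℂ) ^ n) : genFun (f + g) x = genFun f x + genFun g x := by
  simp only [genFun, Pi.add_apply, add_mul]
  exact hf.tsum_add hg

lemma genFun_neg {f : ℕ → ℂ} {x : ℝ} : genFun (-f) x = -genFun f x := by
  simp only [genFun, Pi.neg_apply, neg_mul, tsum_neg]

lemma mul_genFun_succ {f : ℕ → ℂ} {x : ℝ} (hf : Summable fun n => f n * (x : ℂ) ^ n) :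
    x * genFun (fun n => f (n + 1)) x = genFun f x - f 0 := by
  rw [genFun, genFun, hf.tsum_eq_zero_add, ← tsum_mul_left]
  simp only [pow_zero, mul_one, add_sub_cancel_left]
  exact tsum_congr fun n => by ring

lemma hasDerivAt_genFun {f : ℕ → ℂ} {C : ℝ} (hf : ∀ n, ‖f n‖ ≤ C) {x : ℝ} (hx : |x| < 1) :
    HasDerivAt (genFun f) (genFun (fun n => (n + 1) * f (n + 1)) x) x := by
  obtain ⟨r, hxr, hr⟩ := exists_between hx
  have hr0 : 0 ≤ r := (abs_nonneg x).trans hxr.le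
  have hC : 0 ≤ C := (norm_nonneg _).trans (hf 0)
  have hu : Summable fun n : ℕ => C * (n * r ^ (n - 1)) := by
    refine Summable.mul_left C ((summable_nat_add_iff 1).1 ?_)
    have h1 := summable_pow_mul_geometric_of_norm_lt_one 1
      (show ‖r‖ < 1 by rwa [Real.norm_of_nonneg hr0])
    have h2 := summable_geometric_of_lt_one hr0 hr
    refine (h1.add h2).congr fun n => ?_
    push_cast
    ring
  have h := hasDerivAt_tsum_of_isPreconnected (g := fun n (y : ℝ) => f n * (y : ℂ) ^ n)
    (g' := fun n (y : ℝ) => f n * (n * (y : ℂ) ^ (n - 1))) (t := Set.Ioo (-r) r) (y₀ := x) (y := x)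
    hu isOpen_Ioo isPreconnected_Ioo
    (fun n y _ => by
      have h := ((hasDerivAt_id y).ofReal_comp.pow n).const_mul (f n)
      refine h.congr_deriv ?_
      simp)
    (fun n y hy => by
      rw [norm_mul, norm_mul, norm_pow, Complex.norm_natCast, Complex.norm_real, Real.norm_eq_abs]
      have : |y| ≤ r := (abs_lt.2 hy).le
      gcongr
      exact hf n)
    (abs_lt.1 hxr) (summable_genFun hf hx) (abs_lt.1 hxr)
  refine h.congr_deriv ?_
  have hs : Summable fun n => f n * (n * (x : ℂ) ^ (n - 1)) :=
    Summable.of_norm_bounded hu fun n => by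
      rw [norm_mul, norm_mul, norm_pow, Complex.norm_natCast, Complex.norm_real, Real.norm_eq_abs]
      gcongr
      exact hf n
  rw [hs.tsum_eq_zero_add, genFun]
  simp only [Nat.cast_zero, zero_mul, mul_zero, zero_add, Nat.add_sub_cancel]
  exact tsum_congr fun n => by push_cast; ring

lemma hasDerivAt_genFun_intZero {f : ℕ → ℂ} (hf : SqrtDecay f) {x : ℝ} (hx : |x| < 1) :
    HasDerivAt (genFun (intZero f)) (genFun (fun n => f (n + 1)) x) x := by
  obtain ⟨C, hC⟩ := hf.intZero.exists_bound
  refine (hasDerivAt_genFun hC hx).congr_deriv ?_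
  congr 1
  ext n
  have : (n : ℂ) + 1 ≠ 0 := by exact_mod_cast n.succ_ne_zero
  rw [intZero_apply]
  push_cast
  field_simp

lemma norm_mul_ofReal_lt_one {η : ℂ} (hη : ‖η‖ = 1) {x : ℝ} (hx : |x| < 1) :
    ‖η * (x : ℂ)‖ < 1 := by
  rwa [norm_mul, hη, one_mul, Complex.norm_real]

lemma one_sub_mul_ne_zero {η : ℂ} (hη : ‖η‖ = 1) {x : ℝ} (hx : |x| < 1) :
    1 - η * (x : ℂ) ≠ 0 := by
  intro h
  have := norm_mul_ofReal_lt_one hη hx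
  rw [← sub_eq_zero.1 h, norm_one] at this
  exact lt_irrefl _ this

/-- The convolution in `intRoot` is the Cauchy product of f with the geometric series of η/(1 - ηx).
-/
lemma hasDerivAt_genFun_intRoot {f : ℕ → ℂ} (hf : SqrtDecay f) {η : ℂ} (hη : ‖η‖ = 1) {x : ℝ}
    (hx : |x| < 1) :
    HasDerivAt (genFun (intRoot η f)) (η / (1 - η * x) * genFun f x) x := by
  obtain ⟨C, hC⟩ := (hf.intRoot hη).exists_bound
  obtain ⟨D, hD⟩ := hf.exists_bound
  refine (hasDerivAt_genFun hC hx).congr_deriv ?_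
  have h1 : Summable fun n => ‖f n * (x : ℂ) ^ n‖ := (summable_genFun hD hx).norm
  have h2 : Summable fun n => ‖(η * (x : ℂ)) ^ n‖ :=
    summable_norm_geometric_of_norm_lt_one (norm_mul_ofReal_lt_one hη hx)
  have h3 := tsum_mul_tsum_eq_tsum_sum_range_of_summable_norm h1 h2
  rw [tsum_geometric_of_norm_lt_one (norm_mul_ofReal_lt_one hη hx)] at h3
  rw [div_mul_eq_mul_div, mul_div_assoc, div_eq_mul_inv, genFun, genFun, h3, ← tsum_mul_left]
  refine tsum_congr fun n => ?_
  have hn : (n : ℂ) + 1 ≠ 0 := by exact_mod_cast n.succ_ne_zero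
  rw [intRoot_apply]
  push_cast
  rw [mul_div_cancel₀ _ hn, Finset.sum_mul, Finset.mul_sum]
  refine Finset.sum_congr rfl fun m hm => ?_
  obtain ⟨d, rfl⟩ := Nat.exists_eq_add_of_le (Nat.lt_succ_iff.1 (Finset.mem_range.1 hm))
  rw [show m + d + 1 - m = d + 1 by lia, show m + d - m = d by lia]
  ring

/-! ### Pulling back along u -/

/-- The rational function `u(x) = 2(1 - c)x / (x² - 2cx + 1)`. -/
noncomputable def quadMap (c x : ℝ) : ℝ := (1 - c) * quadKernel c x

lemma quadMap_nonneg {c x : ℝ} (hc : c < 1) (hx : 0 ≤ x) : 0 ≤ quadMap c x :=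
  mul_nonneg (sub_pos.2 hc).le (div_nonneg (by linarith) (quad_pos hc hx).le)

lemma quadMap_lt_one {c x : ℝ} (hc : c < 1) (hx : 0 ≤ x) (hx1 : x < 1) : quadMap c x < 1 := by
  rw [quadMap, quadKernel, mul_div_assoc', div_lt_one (quad_pos hc hx)]
  -- Denominator minus numerator is (1 - x)².
  nlinarith [sq_pos_of_pos (sub_pos.2 hx1)]

lemma quadMap_pos {c x : ℝ} (hc : c < 1) (hx : 0 < x) : 0 < quadMap c x :=
  mul_pos (sub_pos.2 hc) (div_pos (by linarith) (quad_pos hc hx.le))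

lemma abs_quadMap_lt_one {c x : ℝ} (hc : c < 1) (hx : 0 ≤ x) (hx1 : x < 1) :
    |quadMap c x| < 1 := by
  rw [abs_of_nonneg (quadMap_nonneg hc hx)]
  exact quadMap_lt_one hc hx hx1

lemma eq_zero_of_hasDerivAt_zero {g : ℝ → ℂ} (hg : ContinuousOn g (Set.Ico 0 1))
    (hg' : ∀ x ∈ Set.Ioo (0 : ℝ) 1, HasDerivAt g 0 x) (h0 : g 0 = 0) {x : ℝ}
    (hx : x ∈ Set.Ico (0 : ℝ) 1) : g x = 0 := by
  have h := intervalIntegral.integral_eq_sub_of_hasDerivAt_of_le (f' := fun _ => (0 : ℂ)) hx.1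
    (hg.mono fun y hy => ⟨hy.1, hy.2.trans_lt hx.2⟩)
    (fun y hy => hg' y ⟨hy.1, hy.2.trans hx.2⟩) (by simp)
  simpa [h0] using h.symm

/-- The substitution `u = quadMap c x` turns the power series with coefficients `a` into the one
with coefficients `f`. -/
def Transfers (c : ℝ) (a f : ℕ → ℂ) : Prop :=
  ∀ x ∈ Set.Ico (0 : ℝ) 1, genFun a (quadMap c x) = genFun f x

lemma transfers_of_hasDerivAt {c : ℝ} (hc : c < 1) {a f : ℕ → ℂ} (ha0 : a 0 = 0) (hf0 : f 0 = 0) {a' f' : ℝ → ℂ}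
    (ha' : ∀ x, |x| < 1 → HasDerivAt (genFun a) (a' x) x)
    (hf' : ∀ x, |x| < 1 → HasDerivAt (genFun f) (f' x) x)
    (h : ∀ x ∈ Set.Ioo (0 : ℝ) 1,
      ((1 - c) * (2 * (1 - x ^ 2) / (x ^ 2 - 2 * c * x + 1) ^ 2) : ℝ) * a' (quadMap c x) = f' x) :
    Transfers c a f := by
  have key : ∀ x ∈ Set.Ico (0 : ℝ) 1, HasDerivAt (fun x => genFun a (quadMap c x) - genFun f x)
      (((1 - c) * (2 * (1 - x ^ 2) / (x ^ 2 - 2 * c * x + 1) ^ 2) : ℝ) * a' (quadMap c x)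
        - f' x) x := by
    intro x hx
    have h1 := (ha' _ (abs_quadMap_lt_one hc hx.1 hx.2)).scomp x
      ((hasDerivAt_quadKernel hc hx.1).const_mul (1 - c))
    have h2 := hf' x (by rw [abs_of_nonneg hx.1]; exact hx.2)
    refine (h1.sub h2).congr_deriv ?_
    rw [Complex.real_smul]
  intro x hx
  refine sub_eq_zero.1 (eq_zero_of_hasDerivAt_zero
    (g := fun x => genFun a (quadMap c x) - genFun f x)
    (fun y hy => (key y hy).continuousAt.continuousWithinAt) (fun y hy => ?_) ?_ hx)
  · refine (key y ⟨hy.1.le, hy.2⟩).congr_deriv ?_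
    rw [h y hy, sub_self]
  · simp [quadMap, quadKernel, genFun_zero, ha0, hf0]

section

variable {c : ℝ} {μ ν : ℂ}

lemma quad_eq_mul (h1 : μ * ν = 1) (h2 : μ + ν = 2 * c) (x : ℝ) :
    ((x ^ 2 - 2 * c * x + 1 : ℝ) : ℂ) = (1 - μ * x) * (1 - ν * x) := by
  push_cast
  linear_combination (-(x : ℂ) ^ 2) * h1 + (x : ℂ) * h2

lemma intZero_zero (f : ℕ → ℂ) : intZero f 0 = 0 := by simp [intZero_apply]

lemma intRoot_zero (η : ℂ) (f : ℕ → ℂ) : intRoot η f 0 = 0 := by simp [intRoot_apply]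

/-- Logarithmic differentiation of u = 2(1 - c)x/((1 - μx)(1 - νx)) gives du/u as a sum of three
forms. Vanishing at index 0 keeps the integrand against dx/x regular. -/
lemma Transfers.intZero (hc : c < 1) (h1 : μ * ν = 1) (h2 : μ + ν = 2 * c) (hμ : ‖μ‖ = 1)
    (hν : ‖ν‖ = 1) {a f : ℕ → ℂ} (ha0 : a 0 = 0) (hf0 : f 0 = 0) (ha : SqrtDecay a)
    (hf : SqrtDecay f) (h : Transfers c a f) :
    Transfers c (intZero a) (intZero f + intRoot μ f + intRoot ν f) := by
  obtain ⟨A, hA⟩ := ha.exists_bound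
  obtain ⟨B, hB⟩ := hf.exists_bound
  obtain ⟨B0, hB0⟩ := hf.intZero.exists_bound
  obtain ⟨B1, hB1⟩ := (hf.intRoot hμ).exists_bound
  obtain ⟨B2, hB2⟩ := (hf.intRoot hν).exists_bound
  obtain ⟨B3, hB3⟩ := (hf.intZero.add (hf.intRoot hμ)).exists_bound
  refine transfers_of_hasDerivAt hc (intZero_zero a)
    (by simp [intZero_zero, intRoot_zero])
    (fun x hx => hasDerivAt_genFun_intZero ha hx) (fun x hx => ?_)
    (f' := fun x => genFun (fun n => f (n + 1)) x + μ / (1 - μ * x) * genFun f x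
      + ν / (1 - ν * x) * genFun f x) ?_
  · have e : genFun (_root_.intZero f + intRoot μ f + intRoot ν f) =ᶠ[𝓝 x]
        fun y => genFun (_root_.intZero f) y + genFun (intRoot μ f) y + genFun (intRoot ν f) y := by
      filter_upwards [(isOpen_lt continuous_abs continuous_const).mem_nhds hx] with y hy
      rw [genFun_add (summable_genFun hB3 hy) (summable_genFun hB2 hy),
        genFun_add (summable_genFun hB0 hy) (summable_genFun hB1 hy)]
    exact (((hasDerivAt_genFun_intZero hf hx).add (hasDerivAt_genFun_intRoot hf hμ hx)).add
      (hasDerivAt_genFun_intRoot hf hν hx)).congr_of_eventuallyEq e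
  · intro x hx
    have hx1 : |x| < 1 := by rw [abs_of_pos hx.1]; exact hx.2
    have e1 := mul_genFun_succ (summable_genFun hA (abs_quadMap_lt_one hc hx.1.le hx.2))
    have e2 := mul_genFun_succ (summable_genFun hB hx1)
    rw [h x ⟨hx.1.le, hx.2⟩, ha0, sub_zero] at e1
    rw [hf0, sub_zero] at e2
    have hx0 : (x : ℂ) ≠ 0 := Complex.ofReal_ne_zero.2 hx.1.ne'
    have hu0 : (quadMap c x : ℂ) ≠ 0 := Complex.ofReal_ne_zero.2 (quadMap_pos hc hx.1).ne'
    have n1 := one_sub_mul_ne_zero hμ hx1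
    have n2 := one_sub_mul_ne_zero hν hx1
    apply mul_left_cancel₀ hu0
    rw [mul_left_comm, e1, ← e2]
    have hq := quad_eq_mul h1 h2 x
    rw [quadMap, quadKernel]
    push_cast at hq ⊢
    rw [hq]
    generalize genFun (fun n => f (n + 1)) x = G
    generalize hp : 1 - μ * (x : ℂ) = p at *
    generalize hr : 1 - ν * (x : ℂ) = r at *
    field_simp
    rw [← hp, ← hr]
    linear_combination (G * (1 - (c : ℂ)) * x ^ 2) * h1

/-- Logarithmic differentiation of 1 - u = (1 - x)²/((1 - μx)(1 - νx)); the square accounts for the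
doubled `intRoot 1 f`. -/
lemma Transfers.intRoot_one (hc : c < 1) (h1 : μ * ν = 1) (h2 : μ + ν = 2 * c) (hμ : ‖μ‖ = 1)
    (hν : ‖ν‖ = 1) {a f : ℕ → ℂ} (ha : SqrtDecay a) (hf : SqrtDecay f) (h : Transfers c a f) :
    Transfers c (intRoot 1 a) (intRoot 1 f + intRoot 1 f - intRoot μ f - intRoot ν f) := by
  have h11 : ‖(1 : ℂ)‖ = 1 := norm_one
  obtain ⟨B0, hB0⟩ := (hf.intRoot h11).exists_bound
  obtain ⟨B1, hB1⟩ := (hf.intRoot hμ).neg.exists_bound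
  obtain ⟨B2, hB2⟩ := (hf.intRoot hν).neg.exists_bound
  obtain ⟨B3, hB3⟩ := ((hf.intRoot h11).add (hf.intRoot h11)).exists_bound
  obtain ⟨B4, hB4⟩ := (((hf.intRoot h11).add (hf.intRoot h11)).add
    (hf.intRoot hμ).neg).exists_bound
  refine transfers_of_hasDerivAt hc (intRoot_zero 1 a)
    (by simp [intRoot_zero])
    (fun x hx => hasDerivAt_genFun_intRoot ha h11 hx) (fun x hx => ?_)
    (f' := fun x => 1 / (1 - 1 * x) * genFun f x + 1 / (1 - 1 * x) * genFun f x
      - μ / (1 - μ * x) * genFun f x - ν / (1 - ν * x) * genFun f x) ?_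
  · have e : genFun (intRoot 1 f + intRoot 1 f - intRoot μ f - intRoot ν f) =ᶠ[𝓝 x]
        fun y => genFun (intRoot 1 f) y + genFun (intRoot 1 f) y - genFun (intRoot μ f) y
          - genFun (intRoot ν f) y := by
      filter_upwards [(isOpen_lt continuous_abs continuous_const).mem_nhds hx] with y hy
      rw [sub_eq_add_neg, sub_eq_add_neg _ (intRoot μ f),
        genFun_add (summable_genFun hB4 hy) (summable_genFun hB2 hy),
        genFun_add (summable_genFun hB3 hy) (summable_genFun hB1 hy),
        genFun_add (summable_genFun hB0 hy) (summable_genFun hB0 hy), genFun_neg, genFun_neg]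
      ring
    exact ((((hasDerivAt_genFun_intRoot hf h11 hx).add
      (hasDerivAt_genFun_intRoot hf h11 hx)).sub (hasDerivAt_genFun_intRoot hf hμ hx)).sub
      (hasDerivAt_genFun_intRoot hf hν hx)).congr_of_eventuallyEq e
  · intro x hx
    have hx1 : |x| < 1 := by rw [abs_of_pos hx.1]; exact hx.2
    rw [h x ⟨hx.1.le, hx.2⟩]
    have n0 : 1 - (x : ℂ) ≠ 0 := by simpa using one_sub_mul_ne_zero h11 hx1
    have n1 := one_sub_mul_ne_zero hμ hx1
    have n2 := one_sub_mul_ne_zero hν hx1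
    have hq := quad_eq_mul h1 h2 x
    have hu : 1 - 1 * (quadMap c x : ℂ) = (1 - x) ^ 2 / ((1 - μ * x) * (1 - ν * x)) := by
      rw [quadMap, quadKernel]
      push_cast at hq ⊢
      rw [← hq]
      have hq0 : (x : ℂ) ^ 2 - 2 * c * x + 1 ≠ 0 := by rw [hq]; exact mul_ne_zero n1 n2
      generalize hq' : (x : ℂ) ^ 2 - 2 * c * x + 1 = q at *
      field_simp
      rw [← hq']
      ring
    rw [hu]
    push_cast at hq ⊢
    rw [hq]
    generalize genFun f x = G
    have hc2 : (c : ℂ) = (μ + ν) / 2 := by rw [h2]; ring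
    have hν' : ν = μ⁻¹ := eq_inv_of_mul_eq_one_right h1
    rw [hc2]
    field_simp
    linear_combination (2 * (x : ℂ) ^ 2 - 2 * x) * G * h1

end

lemma transfers_polylogCoeff_nil (c : ℝ) : Transfers c (polylogCoeff []) (polylogCoeff []) := by
  have h (x : ℝ) : genFun (polylogCoeff []) x = 1 := by
    rw [genFun, tsum_eq_single 0]
    · simp [polylogCoeff]
    · intro n hn
      simp [polylogCoeff, hn]
  intro x _
  rw [h, h]

/-! ### Termwise integration -/

/-- Both series compute ∫₀¹ (∑ aₙ uⁿ) dx/x: one by exchanging sum and integral, the other by the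
fundamental theorem of calculus for the transferred power series. -/
lemma hasSum_mul_kernelMoment {c : ℝ} (hc : c < 1) {a : ℕ → ℝ} (ha : ∀ n, 0 ≤ a n)
    (ha0 : a 0 = 0) {f : ℕ → ℂ} (hf0 : f 0 = 0) (had : SqrtDecay fun n => (a n : ℂ))
    (hf : SqrtDecay f) (h : Transfers c (fun n => (a n : ℂ)) f) :
    ∃ S : ℝ, HasSum (fun n => a (n + 1) * (1 - c) ^ (n + 1) * kernelMoment c n) S ∧
      HasSum (intZero f) S := by
  set t : ℕ → ℝ → ℝ := fun n x => a (n + 1) * (1 - c) ^ (n + 1) *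
    (quadKernel c x ^ n * (2 / (x ^ 2 - 2 * c * x + 1))) with ht
  have hc' : 0 < 1 - c := sub_pos.2 hc
  have ht0 : ∀ n, ∀ x, 0 ≤ x → 0 ≤ t n x := fun n x hx => by
    have h1 := quad_pos hc hx
    have h2 : 0 ≤ quadKernel c x := div_nonneg (by linarith) h1.le
    have h3 := ha (n + 1)
    positivity
  obtain ⟨A, hA⟩ := had.exists_bound
  obtain ⟨B, hB⟩ := hf.exists_bound
  have hsum : ∀ x ∈ Set.Ioo (0 : ℝ) 1,
      HasSum (fun n => ((t n x : ℝ) : ℂ)) (genFun (fun n => f (n + 1)) x) := by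
    intro x hx
    have hx1 : |x| < 1 := by rw [abs_of_pos hx.1]; exact hx.2
    have hx0 : (x : ℂ) ≠ 0 := Complex.ofReal_ne_zero.2 hx.1.ne'
    have hsu := summable_genFun hA (abs_quadMap_lt_one hc hx.1.le hx.2)
    have h2 := (hasSum_nat_add_iff' 1).2 hsu.hasSum
    have e : genFun (fun n => f (n + 1)) x
        = (x : ℂ)⁻¹ * (genFun (fun n => (a n : ℂ)) (quadMap c x)
          - ∑ i ∈ Finset.range 1, (a i : ℂ) * (quadMap c x : ℂ) ^ i) := by
      have h3 := mul_genFun_succ (summable_genFun hB hx1)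
      rw [h x ⟨hx.1.le, hx.2⟩]
      rw [hf0, sub_zero] at h3
      simp only [Finset.range_one, Finset.sum_singleton, ha0, Complex.ofReal_zero, zero_mul,
        sub_zero]
      rw [← h3]
      field_simp
    rw [e]
    refine (h2.mul_left ((x : ℂ)⁻¹)).congr_fun fun n => ?_
    have hq := (quad_pos hc hx.1.le).ne'
    rw [ht]
    have hr : a (n + 1) * (1 - c) ^ (n + 1) *
        (quadKernel c x ^ n * (2 / (x ^ 2 - 2 * c * x + 1)))
        = x⁻¹ * (a (n + 1) * quadMap c x ^ (n + 1)) := by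
      have hx0 := hx.1.ne'
      have hk : 2 / (x ^ 2 - 2 * c * x + 1) = x⁻¹ * quadKernel c x := by
        rw [quadKernel]
        field_simp
      rw [hk, quadMap, mul_pow, pow_succ (quadKernel c x)]
      ring
    simp only [hr]
    push_cast
    rfl
  set Φ := genFun (intZero f) with hΦ
  have hcont : ContinuousOn Φ (Set.Icc 0 1) := by
    refine continuousOn_tsum (fun n => by fun_prop) hf.summable_intZero fun n x hx => ?_
    rw [norm_mul, norm_pow, Complex.norm_real, Real.norm_of_nonneg hx.1]
    exact mul_le_of_le_one_right (norm_nonneg _) (pow_le_one₀ hx.1 hx.2)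
  set g : ℝ → ℝ := fun x => ∑' n, t n x with hg
  have hsg : ∀ x ∈ Set.Ioo (0 : ℝ) 1, HasSum (fun n => t n x) (g x) := fun x hx =>
    (Complex.summable_ofReal.1 (hsum x hx).summable).hasSum
  have hgf : ∀ x ∈ Set.Ioo (0 : ℝ) 1, genFun (fun n => f (n + 1)) x = (g x : ℂ) := fun x hx =>
    (hsum x hx).unique (Complex.hasSum_ofReal.2 (hsg x hx))
  have hderiv : ∀ x ∈ Set.Ioo (0 : ℝ) 1, HasDerivAt Φ (g x : ℂ) x := fun x hx => by
    rw [← hgf x hx]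
    exact hasDerivAt_genFun_intZero hf (by rw [abs_of_pos hx.1]; exact hx.2)
  -- The integrand may be unbounded near 1; it is integrable as the nonnegative derivative of a
  -- function continuous on [0, 1].
  have hint : IntervalIntegrable g MeasureTheory.volume 0 1 := by
    refine intervalIntegral.intervalIntegrable_deriv_of_nonneg (g := fun x => (Φ x).re) ?_ ?_ ?_
    · rw [Set.uIcc_of_le zero_le_one]
      exact Complex.continuous_re.comp_continuousOn hcont
    · intro x hx
      rw [min_eq_left zero_le_one, max_eq_right zero_le_one] at hx
      exact Complex.reCLM.hasFDerivAt.comp_hasDerivAt x (hderiv x hx)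
    · intro x hx
      rw [min_eq_left zero_le_one, max_eq_right zero_le_one] at hx
      exact (hsg x hx).nonneg fun n => ht0 n x hx.1.le
  have hFTC : ∫ x in (0 : ℝ)..1, (g x : ℂ) = Φ 1 - Φ 0 :=
    intervalIntegral.integral_eq_sub_of_hasDerivAt_of_le zero_le_one hcont hderiv
      ⟨hint.1.ofReal, hint.2.ofReal⟩
  have hne : ∀ᵐ x : ℝ, x ≠ 1 := MeasureTheory.Measure.ae_ne _ 1
  -- The terms are nonnegative, so they serve as their own majorants; the endpoint 1 is discarded as
  -- a null set.
  have hS := intervalIntegral.hasSum_integral_of_dominated_convergence (a := 0) (b := 1)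
    (μ := MeasureTheory.volume) (F := t) (f := g) t
    (fun n => ((intervalIntegrable_kernelMoment hc n).const_mul _).def'.aestronglyMeasurable)
    (fun n => Eventually.of_forall fun x hx => by
      rw [Set.uIoc_of_le zero_le_one] at hx
      rw [Real.norm_of_nonneg (ht0 n x hx.1.le)])
    (by
      filter_upwards [hne] with x hx1 hx
      rw [Set.uIoc_of_le zero_le_one] at hx
      exact (hsg x ⟨hx.1, lt_of_le_of_ne hx.2 hx1⟩).summable)
    hint
    (by
      filter_upwards [hne] with x hx1 hx
      rw [Set.uIoc_of_le zero_le_one] at hx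
      exact hsg x ⟨hx.1, lt_of_le_of_ne hx.2 hx1⟩)
  refine ⟨_, hS.congr_fun fun n => ?_, ?_⟩
  · simp only [ht]
    rw [intervalIntegral.integral_const_mul, kernelMoment]
  · rw [← intervalIntegral.integral_ofReal, hFTC, hΦ, genFun_zero, intZero_zero, sub_zero]
    have e : genFun (intZero f) 1 = ∑' n, intZero f n := by simp [genFun]
    rw [e]
    exact hf.summable_intZero.of_norm.hasSum

/-! ### Multiple harmonic sums as polylogarithm coefficients -/

lemma multipleHarmonicSum_nonneg (k : List ℕ) (M : ℕ) : 0 ≤ multipleHarmonicSum k M := by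
  induction k generalizing M with
  | nil => simp [multipleHarmonicSum]
  | cons k ks ih =>
    rw [multipleHarmonicSum]
    exact Finset.sum_nonneg fun n _ => mul_nonneg (by positivity) (ih _)

lemma polylogPartialSum_map_one (k : List ℕ) (M : ℕ) :
    polylogPartialSum (k.map fun i => (i, 1)) M = (multipleHarmonicSum k M : ℂ) := by
  induction k generalizing M with
  | nil => simp [multipleHarmonicSum, polylogPartialSum]
  | cons k ks ih =>
    simp only [List.map_cons, multipleHarmonicSum, polylogPartialSum, ih]
    push_cast
    simp

lemma polylogCoeff_zero {k : ℕ} {z : ℂ} {s : List (ℕ × ℂ)} : polylogCoeff ((k, z) :: s) 0 = 0 := by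
  simp [polylogCoeff]

section

variable {c : ℝ} {μ ν : ℂ}

lemma sqrtDecay_polylogCoeff_map_one {k : List ℕ} (hk : ∀ a ∈ k, 1 ≤ a) :
    SqrtDecay (polylogCoeff (k.map fun i => (i, 1))) := by
  refine SqrtDecay.polylogCoeff fun p hp => ?_
  obtain ⟨i, hi, rfl⟩ := List.mem_map.1 hp
  exact ⟨hk i hi, norm_one⟩

/-- The one-variable multiple polylogarithm at `quadMap c x` is a rational combination of multiple
polylogarithms at roots of unity. -/
lemma exists_transfers (hc : c < 1) (h1 : μ * ν = 1) (h2 : μ + ν = 2 * c) {N : ℕ} (hN : N ≠ 0)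
    (hμ : μ ^ N = 1) (hν : ν ^ N = 1) {k : List ℕ} (hk : ∀ a ∈ k, 1 ≤ a) :
    ∃ f ∈ coeffSpan N k.sum, SqrtDecay f ∧ (k ≠ [] → f 0 = 0) ∧
      Transfers c (polylogCoeff (k.map fun i => (i, 1))) f := by
  have nμ := Complex.norm_eq_one_of_pow_eq_one hμ hN
  have nν := Complex.norm_eq_one_of_pow_eq_one hν hN
  induction k with
  | nil => exact ⟨_, polylogCoeff_nil_mem N, SqrtDecay.polylogCoeff_nil, by simp,
      transfers_polylogCoeff_nil c⟩
  | cons l k ih =>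
    have hk' : ∀ a ∈ k, 1 ≤ a := fun a ha => hk a (List.mem_cons_of_mem _ ha)
    obtain ⟨f, hf, hfd, -, hft⟩ := ih hk'
    have hkd := sqrtDecay_polylogCoeff_map_one hk'
    have hl := hk l List.mem_cons_self
    clear hk ih
    -- An entry l is built by one integration against du/(1 - u) followed by l - 1 against du/u.
    induction l, hl using Nat.le_induction with
    | base =>
      refine ⟨intRoot 1 f + intRoot 1 f - intRoot μ f - intRoot ν f, ?_, ?_, ?_, ?_⟩
      · rw [List.sum_cons, add_comm 1]
        have m1 := intRoot_mem hN (one_pow N) hf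
        exact sub_mem (sub_mem (add_mem m1 m1) (intRoot_mem hN hμ hf)) (intRoot_mem hN hν hf)
      · have d1 := hfd.intRoot (norm_one (α := ℂ))
        exact ((d1.add d1).sub (hfd.intRoot nμ)).sub (hfd.intRoot nν)
      · simp [intRoot_zero]
      · have e : polylogCoeff ((1 :: k).map fun i => (i, (1 : ℂ)))
            = intRoot 1 (polylogCoeff (k.map fun i => (i, 1))) := by
          rcases k with _ | ⟨i, k⟩
          · simp [intRoot_polylogCoeff_nil]
          · simp [intRoot_polylogCoeff_cons one_ne_zero]
        rw [e]
        exact hft.intRoot_one hc h1 h2 nμ nν hkd hfd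
    | succ l hl ih =>
      obtain ⟨g, hg, hgd, hg0, hgt⟩ := ih
      have hg0 := hg0 (List.cons_ne_nil _ _)
      refine ⟨intZero g + intRoot μ g + intRoot ν g, ?_, ?_, ?_, ?_⟩
      · rw [List.sum_cons] at hg ⊢
        rw [add_right_comm]
        exact add_mem (add_mem (intZero_mem (by lia) hg) (intRoot_mem hN hμ hg))
          (intRoot_mem hN hν hg)
      · exact (hgd.intZero.add (hgd.intRoot nμ)).add (hgd.intRoot nν)
      · simp [intRoot_zero, intZero_zero]
      · rw [List.map_cons, ← intZero_polylogCoeff]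
        refine hgt.intZero hc h1 h2 nμ nν polylogCoeff_zero hg0 ?_ hgd
        refine sqrtDecay_polylogCoeff_map_one (k := l :: k) fun i hi => ?_
        rcases List.mem_cons.1 hi with rfl | hi
        · exact hl
        · exact hk' i hi

lemma hasSum_multipleHarmonicSum_mul_kernelMoment (hc : c < 1) {l : ℕ} (hl : 1 ≤ l) {k : List ℕ}
    (hk : ∀ a ∈ k, 1 ≤ a) {f : ℕ → ℂ} (hf : SqrtDecay f) (hf0 : f 0 = 0)
    (h : Transfers c (polylogCoeff ((l :: k).map fun i => (i, 1))) f) :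
    ∃ S : ℝ, HasSum (fun n : ℕ => multipleHarmonicSum k n / ((n : ℝ) + 1) ^ l *
      (1 - c) ^ (n + 1) * kernelMoment c n) S ∧ HasSum (intZero f) S := by
  set a : ℕ → ℝ := fun n => if n = 0 then 0 else multipleHarmonicSum k (n - 1) / (n : ℝ) ^ l
    with ha
  have e : polylogCoeff ((l :: k).map fun i => (i, 1)) = fun n => (a n : ℂ) := by
    ext n
    simp only [List.map_cons, polylogCoeff, ha, polylogPartialSum_map_one]
    split_ifs
    · simp
    · push_cast
      rw [one_pow]
      ring
  have hd : SqrtDecay (polylogCoeff ((l :: k).map fun i => (i, 1))) := by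
    refine sqrtDecay_polylogCoeff_map_one fun i hi => ?_
    rcases List.mem_cons.1 hi with rfl | hi
    · exact hl
    · exact hk i hi
  rw [e] at h hd
  obtain ⟨S, hS, hS'⟩ := hasSum_mul_kernelMoment hc (a := a) (fun n => by
    simp only [ha]
    split_ifs
    · exact le_rfl
    · exact div_nonneg (multipleHarmonicSum_nonneg _ _) (by positivity)) (by simp [ha]) hf0 hd hf h
  refine ⟨S, hS.congr_fun fun n => ?_, hS'⟩
  simp [ha]

end

/-! ### Initial values and explicit evaluations in weights two and three -/

lemma kernelMoment_cos_zero_of_ne_pi {θ : ℝ} (h0 : 0 < θ) (h2π : θ < 2 * Real.pi)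
    (hπ : θ ≠ Real.pi) : kernelMoment (Real.cos θ) 0 = (Real.pi - θ) / Real.sin θ := by
  rcases hπ.lt_or_gt with h | h
  · exact kernelMoment_cos_zero h0 h
  · have := kernelMoment_cos_zero (θ := 2 * Real.pi - θ) (by linarith) (by linarith)
    rw [Real.cos_two_pi_sub, Real.sin_two_pi_sub] at this
    rw [this, div_neg, ← neg_div]
    congr 1
    ring

lemma kernelMoment_neg_one_one : kernelMoment (-1) 1 = 1 / 3 := by
  have h := kernelMoment_add_two (c := -1) (by norm_num) 0
  rw [kernelMoment_neg_one_zero] at h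
  norm_num at h
  linarith

lemma hasSum_intZero_polylogCoeff_one {z : ℂ} (hz : ‖z‖ = 1) (k : ℕ) :
    HasSum (intZero (polylogCoeff [(k + 1, z)])) (multiplePolylog [(k + 2, z)]) :=
  (hasSum_intZero_polylogCoeff k.succ_pos hz (by simp)).1

lemma multiplePolylog_one_eq_zeta (k : ℕ) :
    multiplePolylog [(k + 2, 1)] = riemannZeta (k + 2 : ℕ) := by
  rw [zeta_nat_eq_tsum_of_gt_one (by lia), ← (hasSum_intZero_polylogCoeff_one norm_one k).tsum_eq,
    intZero_polylogCoeff]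
  refine tsum_congr fun n => ?_
  rcases eq_or_ne n 0 with rfl | hn
  · simp [polylogCoeff]
  · simp [polylogCoeff, hn, polylogPartialSum]

section

variable {c : ℝ} {μ ν : ℂ}

lemma transfers_one (hc : c < 1) (h1 : μ * ν = 1) (h2 : μ + ν = 2 * c) (hμ : ‖μ‖ = 1)
    (hν : ‖ν‖ = 1) :
    Transfers c (polylogCoeff [(1, 1)]) (polylogCoeff [(1, 1)] + polylogCoeff [(1, 1)]
      - polylogCoeff [(1, μ)] - polylogCoeff [(1, ν)]) := by
  simp only [← intRoot_polylogCoeff_nil]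
  exact (transfers_polylogCoeff_nil c).intRoot_one hc h1 h2 hμ hν SqrtDecay.polylogCoeff_nil
    SqrtDecay.polylogCoeff_nil

lemma sqrtDecay_one {z : ℂ} (hz : ‖z‖ = 1) : SqrtDecay (polylogCoeff [(1, z)]) :=
  SqrtDecay.polylogCoeff (by simpa using hz)

lemma sqrtDecay_transfers_one (hμ : ‖μ‖ = 1) (hν : ‖ν‖ = 1) :
    SqrtDecay (polylogCoeff [(1, 1)] + polylogCoeff [(1, 1)]
      - polylogCoeff [(1, μ)] - polylogCoeff [(1, ν)]) :=
  (((sqrtDecay_one norm_one).add (sqrtDecay_one norm_one)).sub (sqrtDecay_one hμ)).sub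
    (sqrtDecay_one hν)

lemma hasSum_weight_two (hμ : ‖μ‖ = 1) (hν : ‖ν‖ = 1) :
    HasSum (intZero (polylogCoeff [(1, 1)] + polylogCoeff [(1, 1)]
      - polylogCoeff [(1, μ)] - polylogCoeff [(1, ν)]))
      (2 * riemannZeta 2 - multiplePolylog [(2, μ)] - multiplePolylog [(2, ν)]) := by
  have hz : (2 : ℂ) * riemannZeta 2 = multiplePolylog [(2, 1)] + multiplePolylog [(2, 1)] := by
    have := multiplePolylog_one_eq_zeta 0
    norm_num at this
    rw [this]
    ring
  have e {z : ℂ} (hz : ‖z‖ = 1) := hasSum_intZero_polylogCoeff_one hz 0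
  rw [hz]
  simp only [map_sub, map_add]
  exact (((e norm_one).add (e norm_one)).sub (e hμ)).sub (e hν)

/-- The coefficients obtained from the dilogarithm at `quadMap c x`. -/
lemma transfers_two (hc : c < 1) (h1 : μ * ν = 1) (h2 : μ + ν = 2 * c) (hμ : ‖μ‖ = 1)
    (hν : ‖ν‖ = 1) {f : ℕ → ℂ} (hf : f = polylogCoeff [(1, 1)] + polylogCoeff [(1, 1)]
      - polylogCoeff [(1, μ)] - polylogCoeff [(1, ν)]) :
    Transfers c (polylogCoeff [(2, 1)]) (intZero f + intRoot μ f + intRoot ν f) := by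
  subst hf
  rw [← intZero_polylogCoeff]
  exact (transfers_one hc h1 h2 hμ hν).intZero hc h1 h2 hμ hν polylogCoeff_zero
    (by simp [polylogCoeff_zero]) (sqrtDecay_one norm_one) (sqrtDecay_transfers_one hμ hν)

/-- The `intZero f` part gives the zeta and Li₃ terms. In the other two parts the twists by μ⁻¹ = ν
and ν⁻¹ = μ produce the inner arguments ν, 1, ν² and μ, μ², 1. -/
lemma hasSum_weight_three (h1 : μ * ν = 1) (hμ : ‖μ‖ = 1) (hν : ‖ν‖ = 1) {f : ℕ → ℂ}
    (hf : f = polylogCoeff [(1, 1)] + polylogCoeff [(1, 1)]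
      - polylogCoeff [(1, μ)] - polylogCoeff [(1, ν)]) :
    HasSum (intZero (intZero f + intRoot μ f + intRoot ν f))
      ((2 * multiplePolylog [(2, μ), (1, ν)] - multiplePolylog [(2, μ), (1, 1)]
          - multiplePolylog [(2, μ), (1, ν ^ 2)])
        + (2 * multiplePolylog [(2, ν), (1, μ)] - multiplePolylog [(2, ν), (1, 1)]
          - multiplePolylog [(2, ν), (1, μ ^ 2)])
        + 2 * riemannZeta 3 - multiplePolylog [(3, μ)] - multiplePolylog [(3, ν)]) := by
  have hz : (2 : ℂ) * riemannZeta 3 = multiplePolylog [(3, 1)] + multiplePolylog [(3, 1)] := by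
    have := multiplePolylog_one_eq_zeta 1
    norm_num at this
    rw [this]
    ring
  have hμ0 : μ ≠ 0 := left_ne_zero_of_mul_eq_one h1
  have hν0 : ν ≠ 0 := right_ne_zero_of_mul_eq_one h1
  have hμi : μ⁻¹ = ν := inv_eq_of_mul_eq_one_right h1
  have hνi : ν⁻¹ = μ := inv_eq_of_mul_eq_one_left h1
  have h1' : ν * μ = 1 := by rw [mul_comm, h1]
  have e {z : ℂ} (hz : ‖z‖ = 1) := hasSum_intZero_polylogCoeff_one hz 1
  have d {z w : ℂ} (hz : ‖z‖ = 1) (hw : ‖w‖ = 1) :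
      HasSum (intZero (polylogCoeff [(1, z), (1, w)])) (multiplePolylog [(2, z), (1, w)]) :=
    (hasSum_intZero_polylogCoeff one_pos hz (by simpa using hw)).1
  have hμ2 : ‖μ ^ 2‖ = 1 := by rw [norm_pow, hμ, one_pow]
  have hν2 : ‖ν ^ 2‖ = 1 := by rw [norm_pow, hν, one_pow]
  have h11 : ‖(1 : ℂ)‖ = 1 := norm_one
  rw [hf, hz]
  simp only [map_sub, map_add, intZero_polylogCoeff, intRoot_polylogCoeff_cons hμ0,
    intRoot_polylogCoeff_cons hν0, hμi, hνi, one_mul, h1, h1', ← pow_two]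
  have t1 := (((e h11).add (e h11)).sub (e hμ)).sub (e hν)
  have t2 := (((d hμ hν).add (d hμ hν)).sub (d hμ h11)).sub (d hμ hν2)
  have t3 := (((d hν hμ).add (d hν hμ)).sub (d hν hμ2)).sub (d hν h11)
  simp only [intZero_polylogCoeff] at t1 t2 t3
  convert (t1.add t2).add t3 using 1
  · rfl
  · rfl
  · simp only [Nat.reduceAdd]
    ring

end

/-! ### The main theorem -/

theorem mainTheorem4 (N j : ℕ) (hN : 2 ≤ N) (hj : 1 ≤ j) (hjN : j < N)
    (θ : ℝ) (hθ : θ = 2 * (j : ℝ) * Real.pi / (N : ℝ))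
    (μ : ℂ) (hμ : μ = Complex.exp (Complex.I * (θ : ℂ)))
    (μbar : ℂ) (hμbar : μbar = (starRingEnd ℂ) μ)
    (F : ℕ → ℝ)
    (hF1 : F 1 = if 2 * j = N then 1 else (Real.pi - θ) / Real.sin θ)
    (hF2 : F 2 = if 2 * j = N then 1 / 3 else (Real.cos θ * F 1 + 1) / Real.sin θ ^ 2)
    (hF : ∀ n : ℕ, 2 ≤ n →
      (n : ℝ) * Real.sin θ ^ 2 * F (n + 1) - (2 * (n : ℝ) - 1) * Real.cos θ * F n
        - ((n : ℝ) - 1) * F (n - 1) = 0) :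
    (∀ (l : ℕ) (k : List ℕ), 1 ≤ l → (∀ a ∈ k, 1 ≤ a) →
      ∃ S : ℝ,
        HasSum (fun n : ℕ => multipleHarmonicSum k n / ((n : ℝ) + 1) ^ l
          * (1 - Real.cos θ) ^ (n + 1) * F (n + 1)) S ∧
        (S : ℂ) ∈ CMZV N (k.sum + l + 1)) ∧
    (∃ S : ℝ,
      HasSum (fun n : ℕ => (1 - Real.cos θ) ^ (n + 1) * F (n + 1) / ((n : ℝ) + 1)) S ∧
      (S : ℂ) = 2 * riemannZeta 2 - multiplePolylog [(2, μ)] - multiplePolylog [(2, μbar)] ∧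
      (S : ℂ) ∈ CMZV N 2) ∧
    (∃ S : ℝ,
      HasSum (fun n : ℕ => (1 - Real.cos θ) ^ (n + 1) * F (n + 1) / ((n : ℝ) + 1) ^ 2) S ∧
      (S : ℂ) =
        (2 * multiplePolylog [(2, μ), (1, μbar)] - multiplePolylog [(2, μ), (1, 1)]
          - multiplePolylog [(2, μ), (1, μbar ^ 2)])
        + (2 * multiplePolylog [(2, μbar), (1, μ)] - multiplePolylog [(2, μbar), (1, 1)]
          - multiplePolylog [(2, μbar), (1, μ ^ 2)])
        + 2 * riemannZeta 3 - multiplePolylog [(3, μ)] - multiplePolylog [(3, μbar)] ∧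
      (S : ℂ) ∈ CMZV N 3) := by
  have hN0 : N ≠ 0 := by lia
  have hNR : (0 : ℝ) < N := by exact_mod_cast Nat.pos_of_ne_zero hN0
  have hjR : (0 : ℝ) < j := by exact_mod_cast hj
  have hjNR : (j : ℝ) < N := by exact_mod_cast hjN
  have hpi := Real.pi_pos
  have hθ0 : 0 < θ := by rw [hθ]; positivity
  have hθ2 : θ < 2 * Real.pi := by
    rw [hθ, div_lt_iff₀ hNR]
    nlinarith
  have hθπ : 2 * j = N ↔ θ = Real.pi := by
    rw [hθ, div_eq_iff hNR.ne', mul_comm Real.pi, mul_left_inj' hpi.ne']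
    exact_mod_cast Iff.rfl
  have hc : Real.cos θ < 1 := by
    refine lt_of_le_of_ne (Real.cos_le_one θ) fun h => ?_
    rw [Real.cos_eq_one_iff_of_lt_of_lt (by linarith) hθ2] at h
    exact hθ0.ne' h
  have h2 : μ + μbar = 2 * (Real.cos θ : ℂ) := by
    rw [hμbar, Complex.add_conj, hμ, mul_comm Complex.I, Complex.exp_ofReal_mul_I_re]
    push_cast
    rfl
  have nμ : ‖μ‖ = 1 := by rw [hμ, mul_comm, Complex.norm_exp_ofReal_mul_I]
  have nν : ‖μbar‖ = 1 := by rw [hμbar, Complex.norm_conj, nμ]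
  have h1 : μ * μbar = 1 := by
    rw [hμbar, Complex.mul_conj, Complex.normSq_eq_norm_sq, nμ]
    norm_num
  have hμN : μ ^ N = 1 := by
    rw [hμ, ← Complex.exp_nat_mul, Complex.exp_eq_one_iff]
    refine ⟨j, ?_⟩
    have : (N : ℂ) ≠ 0 := Nat.cast_ne_zero.2 hN0
    rw [hθ]
    push_cast
    field_simp
  have hνN : μbar ^ N = 1 := by rw [hμbar, ← map_pow, hμN, map_one]
  have hs2 : Real.sin θ ^ 2 = 1 - Real.cos θ ^ 2 := Real.sin_sq θ
  have hFm : ∀ n, F (n + 1) = kernelMoment (Real.cos θ) n := by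
    have e1 : F 1 = kernelMoment (Real.cos θ) 0 := by
      rw [hF1]
      split_ifs with h
      · rw [hθπ.1 h, Real.cos_pi, kernelMoment_neg_one_zero]
      · exact (kernelMoment_cos_zero_of_ne_pi hθ0 hθ2 fun h' => h (hθπ.2 h')).symm
    have e2 : F 2 = kernelMoment (Real.cos θ) 1 := by
      rw [hF2]
      split_ifs with h
      · rw [hθπ.1 h, Real.cos_pi, kernelMoment_neg_one_one]
      · have hs : Real.sin θ ≠ 0 := by
          intro h'
          have h3 : Real.sin (θ - Real.pi) = 0 := by rw [Real.sin_sub_pi, h', neg_zero]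
          rw [Real.sin_eq_zero_iff_of_lt_of_lt (by linarith) (by linarith)] at h3
          exact h (hθπ.2 (by linarith))
        rw [div_eq_iff (pow_ne_zero 2 hs), hs2, e1]
        linarith [kernelMoment_one hc]
    exact eq_kernelMoment_of_recurrence hc e1 e2 (by simpa only [hs2] using hF)
      (Real.neg_one_le_cos θ)
  have hmain : ∀ (l : ℕ) (k : List ℕ), 1 ≤ l → (∀ a ∈ k, 1 ≤ a) →
      ∃ S : ℝ,
        HasSum (fun n : ℕ => multipleHarmonicSum k n / ((n : ℝ) + 1) ^ l
          * (1 - Real.cos θ) ^ (n + 1) * F (n + 1)) S ∧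
        (S : ℂ) ∈ CMZV N (k.sum + l + 1) := by
    intro l k hl hk
    have hlk : ∀ a ∈ l :: k, 1 ≤ a := fun a ha => by
      rcases List.mem_cons.1 ha with rfl | ha
      · exact hl
      · exact hk a ha
    obtain ⟨f, hf, hfd, hf0, hft⟩ := exists_transfers hc h1 h2 hN0 hμN hνN hlk
    obtain ⟨S, hS, hS'⟩ := hasSum_multipleHarmonicSum_mul_kernelMoment hc hl hk hfd
      (hf0 (List.cons_ne_nil _ _)) hft
    rw [List.sum_cons, add_comm l] at hf
    obtain ⟨v, hv, hv'⟩ := hasSum_intZero_mem_CMZV hN0 (by lia) hf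
    refine ⟨S, by simpa only [hFm] using hS, ?_⟩
    rw [hS'.unique hv']
    exact hv
  refine ⟨hmain, ?_, ?_⟩
  · obtain ⟨S, hS, hSm⟩ := hmain 1 [] le_rfl (by simp)
    obtain ⟨T, hT, hT'⟩ := hasSum_multipleHarmonicSum_mul_kernelMoment hc (l := 1) (k := []) le_rfl
      (by simp) (sqrtDecay_transfers_one nμ nν) (by simp [polylogCoeff_zero])
      (transfers_one hc h1 h2 nμ nν)
    simp only [← hFm] at hT
    -- The explicit value and the general membership concern the same series, so their sums agree.
    obtain rfl := hT.unique hS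
    refine ⟨T, hT.congr_fun fun n => ?_, hT'.unique (hasSum_weight_two nμ nν), by simpa using hSm⟩
    rw [multipleHarmonicSum]
    ring
  · obtain ⟨S, hS, hSm⟩ := hmain 2 [] one_le_two (by simp)
    have hd := sqrtDecay_transfers_one nμ nν
    obtain ⟨T, hT, hT'⟩ := hasSum_multipleHarmonicSum_mul_kernelMoment hc (l := 2) (k := [])
      one_le_two (by simp) ((hd.intZero.add (hd.intRoot nμ)).add (hd.intRoot nν))
      (by simp [intZero_zero, intRoot_zero]) (transfers_two hc h1 h2 nμ nν rfl)
    simp only [← hFm] at hT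
    obtain rfl := hT.unique hS
    refine ⟨T, hT.congr_fun fun n => ?_, hT'.unique (hasSum_weight_three h1 nμ nν rfl),
      by simpa using hSm⟩
    rw [multipleHarmonicSum]
    ring
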